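/- Let $p$ be an odd prime, let $n\ge 1$ be an integer with $p\mid n$, let $e\ge 1$ be an integer, and let $v_p(n)$ be the exponent of $p$ in $n$. Let $F$ be the number of integers $x$ with $1\le x\le p^e(p-1)$, $p\nmid x$ and $$x^{x^n}\equiv x \pmod{p^e}.$$ For a positive integer $d$ let $N(d)$ be the number of solutions $z\in\mathbb{Z}/d\mathbb{Z}$ of $z^n-1\equiv 0\pmod d$, and let $\phi$ be Euler's function. Put $k=e-1$ if $e\le v_p(n)$, and $k=\lfloor (e+v_p(n))/2\rfloor$ if $e\ge v_p(n)+1$. Then $$F=\sum_{x_0=1}^{p-1}\gcd(p-1,\,x_0^n-1)+\sum_{x_0=1}^{p-1}\gcd(p-1,\,n,\,x_0^n-1)\,(p^k-1)$$ $$=\sum_{d\mid p-1}\phi(d)\,\frac{p-1}{d}\,N(d)+\sum_{d\mid \gcd(n,p-1)}\phi(d)\,\frac{p-1}{d}\,N(d)\,(p^k-1).$$ -/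

import Mathlib

/-- The set of fixed points: the `x ∈ {1, …, p ^ e * (p - 1)}` with `p ∤ x` and
`x ^ (x ^ n) ≡ x (mod p ^ e)`. -/
def fixedPoints (p e n : ℕ) : Finset ℕ :=
  {x ∈ Finset.Icc 1 (p ^ e * (p - 1)) | ¬ p ∣ x ∧ x ^ (x ^ n) ≡ x [MOD p ^ e]}

/-- `N_{x ^ n - 1}(d)`: the number of solutions `z` modulo `d` of `z ^ n - 1 ≡ 0 (mod d)`. -/
noncomputable def rootCount (n d : ℕ) : ℕ :=
  Nat.card {z : ZMod d // z ^ n - 1 = 0}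

/-- The sum `∑ gcd(p - 1, x₀ ^ n - 1) + ∑ gcd(p - 1, n, x₀ ^ n - 1) * (p ^ k - 1)`, both over
`x₀ = 1, …, p - 1`. All subtractions are exact, since `p ≥ 1` and `x₀ ≥ 1`. -/
def gcdSum (p n k : ℕ) : ℕ :=
  (∑ x₀ ∈ Finset.Icc 1 (p - 1), Nat.gcd (p - 1) (x₀ ^ n - 1)) +
    ∑ x₀ ∈ Finset.Icc 1 (p - 1),
      Nat.gcd (p - 1) (Nat.gcd n (x₀ ^ n - 1)) * (p ^ k - 1)

/-- The sum `∑ φ(d) ((p - 1) / d) N(d)` over `d ∣ p - 1`, plus the sum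
`∑ φ(d) ((p - 1) / d) N(d) (p ^ k - 1)` over `d ∣ gcd(n, p - 1)`, where `N = N_{x ^ n - 1}`.
All divisions are exact. -/
noncomputable def divisorSum (p n k : ℕ) : ℕ :=
  (∑ d ∈ (p - 1).divisors, Nat.totient d * ((p - 1) / d) * rootCount n d) +
    ∑ d ∈ (Nat.gcd n (p - 1)).divisors,
      Nat.totient d * ((p - 1) / d) * rootCount n d * (p ^ k - 1)

/-!
The argument counts `x` through its residue `g` in the unit group `G` of `ℤ / p ^ e`, together with
the residue `y ∈ {1, …, p - 1}` of `x` modulo `p - 1`; by the Chinese remainder theorem each pair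
`(g, y)` comes from exactly one `x ≤ p ^ e (p - 1)`. The congruence says `g ^ (x ^ n - 1) = 1`.
Since `G` is cyclic of order `p ^ (e - 1) (p - 1)`, this splits into a condition on the prime-to-`p`
part of `g`, which sees only `y`, namely `g ^ (p ^ (e - 1) (y ^ n - 1)) = 1`, and a condition on the
`p`-part, `g ^ ((p - 1) (x ^ n - 1)) = 1`.

The `p`-part is governed by lifting the exponent (`pPart_condition_iff`). With
`i = v_p (x ^ (p - 1) - 1) ≥ 1` and `x > 1`, the condition reads `e ≤ i + v_p (x ^ n - 1)`. If `p ∤ x ^ n - 1`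
this is `e ≤ i`, i.e. `g ^ (p - 1) = 1`. If `p ∣ x ^ n - 1`, computing `v_p (x ^ (n (p - 1)) - 1)`
in two ways gives `v_p (x ^ n - 1) = i + v_p (n)`, so that the condition is `e ≤ 2 i + v_p (n)`,
which for the stated `k` is `e ≤ i + k`, i.e. `g ^ ((p - 1) p ^ k) = 1`.

All conditions are now of the form `g ^ m = 1`, so inclusion-exclusion in a cyclic group
(`IsCyclic.card_filter_or_pow_eq_one`) counts, for each `y`, `gcd (p - 1, y ^ n - 1)` plus
`gcd (p - 1, n, y ^ n - 1) (p ^ k - 1)` elements `g`. The second formula is the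
identity `∑_{d ∣ m} φ(d) = m` applied to each gcd, followed by an exchange of the summations
(`sum_gcd_pow_sub_one`).
-/

/-! ### Counting in a finite cyclic group -/

theorem IsCyclic.card_filter_pow_eq_one {G : Type*} [CommGroup G] [IsCyclic G] [Fintype G]
    [DecidableEq G] (m : ℕ) :
    (Finset.univ.filter fun g : G => g ^ m = 1).card = (Fintype.card G).gcd m := by
  rw [← Nat.card_eq_fintype_card, ← IsCyclic.card_powMonoidHom_ker (G := G) m,
    ← Fintype.card_subtype, ← Nat.card_eq_fintype_card]
  rfl

theorem pow_eq_one_and_pow_eq_one_iff {G : Type*} [Monoid G] (g : G) (a b : ℕ) :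
    (g ^ a = 1 ∧ g ^ b = 1) ↔ g ^ a.gcd b = 1 := by
  simp only [← orderOf_dvd_iff_pow_eq_one, Nat.dvd_gcd_iff]

/-- Inclusion-exclusion for the solutions of `g ^ a = 1` satisfying one of two further
equations. -/
theorem IsCyclic.card_filter_or_pow_eq_one {G : Type*} [CommGroup G] [IsCyclic G] [Fintype G]
    [DecidableEq G] (a b c : ℕ) :
    (Finset.univ.filter fun g : G => g ^ a = 1 ∧ (g ^ b = 1 ∨ g ^ c = 1)).card
        + (Fintype.card G).gcd (a.gcd (b.gcd c))
      = (Fintype.card G).gcd (a.gcd b) + (Fintype.card G).gcd (a.gcd c) := by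
  simp only [← IsCyclic.card_filter_pow_eq_one, ← pow_eq_one_and_pow_eq_one_iff]
  rw [← Finset.card_union_add_card_inter (Finset.univ.filter fun g : G => g ^ a = 1 ∧ g ^ b = 1),
    ← Finset.filter_or, ← Finset.filter_and]
  congr 2 <;> refine Finset.filter_congr fun g _ => ?_ <;> tauto

/-- If `g ^ (a * b) = 1` with `a`, `b` coprime, then `g ^ m = 1` can be tested on the two
components `g ^ a` and `g ^ b`. -/
theorem pow_eq_one_iff_of_coprime_mul {G : Type*} [Monoid G] (g : G) {a b : ℕ}
    (hab : a.Coprime b) (m : ℕ) : g ^ m = 1 ↔ g ^ (a * m) = 1 ∧ g ^ (b * m) = 1 := by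
  rw [pow_eq_one_and_pow_eq_one_iff, Nat.gcd_mul_right, hab.gcd_eq_one, one_mul]

/-! ### The condition on the `p`-part -/

theorem Nat.Prime.dvd_pow_sub_one_of_not_dvd {p x : ℕ} (hp : p.Prime) (hx : ¬ p ∣ x) :
    p ∣ x ^ (p - 1) - 1 := by
  have hx0 : 0 < x := Nat.pos_of_ne_zero (by rintro rfl; simp at hx)
  have h := Nat.ModEq.pow_totient ((hp.coprime_iff_not_dvd.mpr hx).symm)
  rw [Nat.totient_prime hp] at h
  exact (Nat.modEq_iff_dvd' (Nat.pow_pos hx0)).mp h.symm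

/-- Lifting the exponent identifies the valuation of `x ^ n - 1`, once `p` divides it: both sides
compute the valuation of `x ^ (n (p - 1)) - 1`. -/
theorem padicValNat_pow_sub_one {p x n : ℕ} (hp : p.Prime) (hp2 : p ≠ 2) (hn : 0 < n)
    (hx1 : 1 < x) (hx : ¬ p ∣ x) (h : p ∣ x ^ n - 1) :
    padicValNat p (x ^ n - 1) = padicValNat p (x ^ (p - 1) - 1) + padicValNat p n := by
  have : Fact p.Prime := ⟨hp⟩
  have hodd : Odd p := hp.odd_of_ne_two hp2
  have hp1 : p - 1 ≠ 0 := by have := hp.two_le; omega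
  have hxp : ∀ m, ¬ p ∣ x ^ m := fun m hm => hx (hp.dvd_of_dvd_pow hm)
  have e1 := padicValNat.pow_sub_pow (p := p) (x := x ^ n) (y := 1) hodd
    (Nat.one_lt_pow hn.ne' hx1) h (hxp n) hp1
  have e2 := padicValNat.pow_sub_pow (p := p) (x := x ^ (p - 1)) (y := 1) hodd
    (Nat.one_lt_pow hp1 hx1) (hp.dvd_pow_sub_one_of_not_dvd hx) (hxp _) hn.ne'
  have hz : padicValNat p (p - 1) = 0 :=
    padicValNat.eq_zero_of_not_dvd fun hd => by
      have := Nat.le_of_dvd (by omega) hd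
      omega
  rw [one_pow, ← pow_mul, hz] at e1
  rw [one_pow, ← pow_mul, mul_comm] at e2
  omega

theorem pow_dvd_pow_sub_one_iff {p x m e : ℕ} (hp : p.Prime) (hp2 : p ≠ 2) (hx1 : 1 < x)
    (hx : ¬ p ∣ x) (hm : m ≠ 0) :
    p ^ e ∣ x ^ ((p - 1) * m) - 1 ↔
      e ≤ padicValNat p (x ^ (p - 1) - 1) + padicValNat p m := by
  have : Fact p.Prime := ⟨hp⟩
  have hp1 : p - 1 ≠ 0 := by have := hp.two_le; omega
  have e1 := padicValNat.pow_sub_pow (p := p) (x := x ^ (p - 1)) (y := 1)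
    (hp.odd_of_ne_two hp2) (Nat.one_lt_pow hp1 hx1) (hp.dvd_pow_sub_one_of_not_dvd hx)
    (fun h => hx (hp.dvd_of_dvd_pow h)) hm
  have h0 : x ^ ((p - 1) * m) - 1 ≠ 0 := by
    have := Nat.one_lt_pow (mul_ne_zero hp1 hm) hx1
    omega
  rw [one_pow, ← pow_mul] at e1
  rw [padicValNat_dvd_iff_le h0, e1]

/-- The condition on the `p`-part of `x`. The hypothesis on `k` is how the exponent `k` enters:
`i` stands for the valuation of `x ^ (p - 1) - 1`. -/
theorem pPart_condition_iff {p x n e k : ℕ} (hp : p.Prime) (hp2 : p ≠ 2) (hn : 0 < n)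
    (hx : ¬ p ∣ x)
    (hk : ∀ i, 1 ≤ i → (e ≤ i + (i + padicValNat p n) ↔ e ≤ i + k)) :
    p ^ e ∣ x ^ ((p - 1) * (x ^ n - 1)) - 1 ↔
      p ^ e ∣ x ^ (p - 1) - 1 ∨
        (p ∣ x ^ n - 1 ∧ p ^ e ∣ x ^ ((p - 1) * p ^ k) - 1) := by
  have : Fact p.Prime := ⟨hp⟩
  have hx0 : x ≠ 0 := by rintro rfl; simp at hx
  rcases Nat.lt_or_ge 1 x with hx1 | hx1
  · have hi : 1 ≤ padicValNat p (x ^ (p - 1) - 1) := by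
      refine one_le_padicValNat_of_dvd ?_ (hp.dvd_pow_sub_one_of_not_dvd hx)
      have := Nat.one_lt_pow (n := p - 1) (by have := hp.two_le; omega) hx1
      omega
    have hM : x ^ n - 1 ≠ 0 := by
      have := Nat.one_lt_pow hn.ne' hx1
      omega
    have h1 := pow_dvd_pow_sub_one_iff (e := e) hp hp2 hx1 hx one_ne_zero
    rw [mul_one, padicValNat_one_right, add_zero] at h1
    rw [pow_dvd_pow_sub_one_iff hp hp2 hx1 hx hM,
      pow_dvd_pow_sub_one_iff hp hp2 hx1 hx (pow_ne_zero k hp.ne_zero), h1,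
      padicValNat.prime_pow]
    by_cases hd : p ∣ x ^ n - 1
    · rw [padicValNat_pow_sub_one hp hp2 hn hx1 hx hd, hk _ hi]
      simp only [hd, true_and]
      omega
    · rw [padicValNat.eq_zero_of_not_dvd hd]
      simp [hd]
  · obtain rfl : x = 1 := by omega
    simp

theorem pow_dvd_pow_mul_sub_one_iff {p x n e : ℕ} (hp : p.Prime) (he : 1 ≤ e) (hx0 : 0 < x) :
    p ^ e ∣ x ^ (n * p ^ (e - 1)) - 1 ↔ p ∣ x ^ n - 1 := by
  have : Fact p.Prime := ⟨hp⟩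
  have hcast : ∀ m, ((x ^ m - 1 : ℕ) : ℤ) = (x : ℤ) ^ m - 1 := fun m => by
    rw [Nat.cast_sub (Nat.pow_pos hx0)]; push_cast; rfl
  constructor
  · intro h
    -- Fermat: raising to a power of `p` does not change residues modulo `p`.
    have h1 := (dvd_pow_self p (by omega : e ≠ 0)).trans h
    rw [← Int.natCast_dvd_natCast, hcast, ← ZMod.intCast_zmod_eq_zero_iff_dvd] at h1 ⊢
    push_cast at h1 ⊢
    rwa [pow_mul, ZMod.pow_card_pow] at h1
  · intro h
    rw [← Int.natCast_dvd_natCast, hcast] at h ⊢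
    have := dvd_sub_pow_of_dvd_sub (R := ℤ) h (e - 1)
    rw [one_pow, ← pow_mul, Nat.sub_add_cancel he] at this
    exact_mod_cast this

/-! ### The congruence in the unit group -/

theorem Nat.Prime.coprime_pow_sub_one {p : ℕ} (hp : p.Prime) (j : ℕ) :
    (p ^ j).Coprime (p - 1) := by
  have := hp.two_le
  exact (Nat.coprime_self_sub_right hp.one_le |>.mpr (Nat.coprime_one_right p)).pow_left j

theorem ZMod.unitOfCoprime_pow_eq_one_iff {N x : ℕ} (h : x.Coprime N) (hx0 : 0 < x) (m : ℕ) :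
    ZMod.unitOfCoprime x h ^ m = 1 ↔ N ∣ x ^ m - 1 := by
  rw [← Nat.modEq_iff_dvd' (Nat.pow_pos hx0), Units.ext_iff, Units.val_pow_eq_pow_val,
    ZMod.coe_unitOfCoprime, Units.val_one, Nat.ModEq.comm, ← ZMod.natCast_eq_natCast_iff]
  push_cast
  rfl

theorem Nat.ModEq.pow_sub_one {m x y : ℕ} (h : x ≡ y [MOD m]) (hx : 0 < x) (hy : 0 < y) (n : ℕ) :
    x ^ n - 1 ≡ y ^ n - 1 [MOD m] := by
  apply Nat.ModEq.add_right_cancel' 1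
  rw [Nat.sub_add_cancel (Nat.pow_pos hx), Nat.sub_add_cancel (Nat.pow_pos hy)]
  exact h.pow n

/-- The fixed point congruence as a system of equations `g ^ m = 1` for the class `g` of `x`, in
which `x` otherwise occurs only through a representative `y` of its class modulo `p - 1`. -/
theorem self_power_modEq_iff {p x y n e k : ℕ} (hp : p.Prime) (hp2 : p ≠ 2) (hn : 0 < n)
    (he : 1 ≤ e) (hx : ¬ p ∣ x)
    (hk : ∀ i, 1 ≤ i → (e ≤ i + (i + padicValNat p n) ↔ e ≤ i + k))
    (hc : x.Coprime (p ^ e)) (hy : 0 < y) (hxy : x ≡ y [MOD (p - 1)]) :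
    x ^ (x ^ n) ≡ x [MOD p ^ e] ↔
      ZMod.unitOfCoprime x hc ^ (p ^ (e - 1) * (y ^ n - 1)) = 1 ∧
        (ZMod.unitOfCoprime x hc ^ (p - 1) = 1 ∨
          ZMod.unitOfCoprime x hc ^ ((n * p ^ (e - 1)).gcd ((p - 1) * p ^ k)) = 1) := by
  have hx0 : 0 < x := Nat.pos_of_ne_zero (by rintro rfl; simp at hx)
  have h1 : x ^ (x ^ n) ≡ x [MOD p ^ e] ↔ ZMod.unitOfCoprime x hc ^ (x ^ n - 1) = 1 := by
    rw [← mul_left_inj (ZMod.unitOfCoprime x hc), one_mul, ← pow_succ,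
      Nat.sub_add_cancel (Nat.pow_pos hx0), Units.ext_iff, Units.val_pow_eq_pow_val,
      ZMod.coe_unitOfCoprime, ← ZMod.natCast_eq_natCast_iff]
    push_cast
    rfl
  have hcop := hp.coprime_pow_sub_one (e - 1)
  have hcard : (ZMod.unitOfCoprime x hc ^ p ^ (e - 1)) ^ (p - 1) = 1 := by
    rw [← pow_mul, ← Nat.totient_prime_pow hp he, ZMod.pow_totient]
  have h2 : ZMod.unitOfCoprime x hc ^ (p ^ (e - 1) * (x ^ n - 1)) =
      ZMod.unitOfCoprime x hc ^ (p ^ (e - 1) * (y ^ n - 1)) := by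
    rw [pow_mul, pow_mul]
    exact pow_eq_pow_iff_modEq.mpr
      ((hxy.pow_sub_one hx0 hy n).of_dvd (orderOf_dvd_of_pow_eq_one hcard))
  rw [h1, pow_eq_one_iff_of_coprime_mul _ hcop, h2, ← pow_eq_one_and_pow_eq_one_iff]
  simp only [ZMod.unitOfCoprime_pow_eq_one_iff hc hx0]
  rw [pPart_condition_iff hp hp2 hn hx hk, pow_dvd_pow_mul_sub_one_iff hp he hx0]

/-! ### Counting the fixed points -/

/-- The number of classes `g` completing a given residue `y` modulo `p - 1` to a fixed point, where
`t` stands for `y ^ n - 1`. -/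
theorem card_units_satisfying {p n e k t : ℕ} [NeZero (p ^ e)] (hp : p.Prime) (hp2 : p ≠ 2)
    (he : 1 ≤ e) (hke : k ≤ e - 1) :
    (Finset.univ.filter fun g : (ZMod (p ^ e))ˣ => g ^ (p ^ (e - 1) * t) = 1 ∧
        (g ^ (p - 1) = 1 ∨ g ^ ((n * p ^ (e - 1)).gcd ((p - 1) * p ^ k)) = 1)).card =
      (p - 1).gcd t + (p - 1).gcd (n.gcd t) * (p ^ k - 1) := by
  have := ZMod.isCyclic_units_of_prime_pow p hp hp2 e
  have h := IsCyclic.card_filter_or_pow_eq_one (G := (ZMod (p ^ e))ˣ) (p ^ (e - 1) * t) (p - 1)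
    ((n * p ^ (e - 1)).gcd ((p - 1) * p ^ k))
  rw [ZMod.card_units_eq_totient, Nat.totient_prime_pow hp he] at h
  -- The powers of `p` drop out of a gcd with `p - 1`.
  have hg : ∀ j s, (p - 1).gcd (p ^ j * s) = (p - 1).gcd s := fun j s =>
    (hp.coprime_pow_sub_one j).gcd_mul_left_cancel_right s
  have e1 : (p ^ (e - 1) * (p - 1)).gcd ((p ^ (e - 1) * t).gcd (p - 1)) = (p - 1).gcd t := by
    rw [Nat.gcd_comm (p ^ (e - 1) * t), hg, ← Nat.gcd_assoc,
      Nat.gcd_eq_right (Dvd.intro_left _ rfl)]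
  have e2 : (p ^ (e - 1) * (p - 1)).gcd ((p ^ (e - 1) * t).gcd
      ((n * p ^ (e - 1)).gcd ((p - 1) * p ^ k))) = p ^ k * (p - 1).gcd (n.gcd t) := by
    obtain ⟨j, hj⟩ := Nat.exists_eq_add_of_le hke
    have hdvd : (p - 1) * p ^ k ∣ p ^ (e - 1) * (p - 1) :=
      ⟨p ^ j, by rw [hj, pow_add]; ring⟩
    rw [← Nat.gcd_assoc (p ^ (e - 1) * t), mul_comm n, Nat.gcd_mul_left, ← Nat.gcd_assoc,
      Nat.gcd_comm (p ^ (e - 1) * (p - 1)), Nat.gcd_assoc, Nat.gcd_eq_right hdvd,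
      Nat.gcd_comm, Nat.gcd_comm t n, hj, pow_add, mul_comm (p - 1), mul_assoc, Nat.gcd_mul_left,
      hg]
  have e3 : (p ^ (e - 1) * (p - 1)).gcd ((p ^ (e - 1) * t).gcd
      ((p - 1).gcd ((n * p ^ (e - 1)).gcd ((p - 1) * p ^ k)))) = (p - 1).gcd (n.gcd t) := by
    have h1 : (p - 1).gcd ((n * p ^ (e - 1)).gcd ((p - 1) * p ^ k)) = (p - 1).gcd n := by
      rw [Nat.gcd_comm (n * p ^ (e - 1)), ← Nat.gcd_assoc, Nat.gcd_eq_left (Dvd.intro _ rfl),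
        mul_comm n, hg]
    rw [h1, ← Nat.gcd_assoc (p ^ (e - 1) * t), Nat.gcd_comm (p ^ (e - 1) * t), hg, Nat.gcd_assoc,
      ← Nat.gcd_assoc, Nat.gcd_eq_right (Dvd.intro_left _ rfl), Nat.gcd_comm t]
  rw [e1, e2, e3] at h
  have hpk : p ^ k * (p - 1).gcd (n.gcd t) =
      (p - 1).gcd (n.gcd t) * (p ^ k - 1) + (p - 1).gcd (n.gcd t) := by
    rw [← Nat.mul_succ, Nat.succ_eq_add_one, Nat.sub_add_cancel (Nat.pow_pos hp.pos), mul_comm]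
  linarith

/-- A natural number prime to `p` in `[1, p ^ e (p - 1)]` is the same as a unit modulo `p ^ e`
together with a residue modulo `p - 1`. -/
theorem card_filter_modEq_eq_card_units {p e y : ℕ} [NeZero (p ^ e)] (hp : p.Prime)
    (he : 1 ≤ e) (P : ℕ → Prop) [DecidablePred P] (Q : (ZMod (p ^ e))ˣ → Prop) [DecidablePred Q]
    (hPQ : ∀ x (hc : x.Coprime (p ^ e)), x ≡ y [MOD (p - 1)] →
      (P x ↔ Q (ZMod.unitOfCoprime x hc))) :
    ((Finset.Icc 1 (p ^ e * (p - 1))).filter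
        fun x => (¬ p ∣ x ∧ P x) ∧ x ≡ y [MOD (p - 1)]).card =
      (Finset.univ.filter Q).card := by
  have hp1 : 0 < p - 1 := by have := hp.two_le; omega
  have hcop := hp.coprime_pow_sub_one e
  have hN : 0 < p ^ e * (p - 1) := Nat.mul_pos (Nat.pow_pos hp.pos) hp1
  have hc : ∀ x, ¬ p ∣ x → x.Coprime (p ^ e) := fun x hx =>
    (Nat.Coprime.pow_left _ ((hp.coprime_iff_not_dvd).mpr hx)).symm
  have hlt : ∀ x, x ∈ Finset.Icc 1 (p ^ e * (p - 1)) → ¬ p ∣ x → x < p ^ e * (p - 1) := by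
    intro x hx hpx
    refine lt_of_le_of_ne (Finset.mem_Icc.mp hx).2 ?_
    rintro rfl
    exact hpx ((dvd_pow_self p (by omega)).mul_right _)
  refine Finset.card_bij (fun x hx => ZMod.unitOfCoprime x
    (hc x (Finset.mem_filter.mp hx).2.1.1)) ?_ ?_ ?_
  · intro x hx
    obtain ⟨-, ⟨hpx, hP⟩, hxy⟩ := Finset.mem_filter.mp hx
    exact Finset.mem_filter.mpr ⟨Finset.mem_univ _, (hPQ x _ hxy).mp hP⟩
  · intro x hx x' hx' h
    obtain ⟨hm, ⟨hpx, -⟩, hxy⟩ := Finset.mem_filter.mp hx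
    obtain ⟨hm', ⟨hpx', -⟩, hxy'⟩ := Finset.mem_filter.mp hx'
    have h1 : x ≡ x' [MOD p ^ e] := by
      rw [← ZMod.natCast_eq_natCast_iff]
      simpa using congrArg Units.val h
    exact Nat.ModEq.eq_of_lt_of_lt
      ((Nat.modEq_and_modEq_iff_modEq_mul hcop).mp ⟨h1, hxy.trans hxy'.symm⟩)
      (hlt x hm hpx) (hlt x' hm' hpx')
  · intro g hg
    obtain ⟨x, hx1, hx2⟩ := Nat.chineseRemainder hcop (g : ZMod (p ^ e)).val y
    have hxm : x % (p ^ e * (p - 1)) ≡ x [MOD p ^ e * (p - 1)] := Nat.mod_modEq _ _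
    have h1 := (hxm.of_dvd (Dvd.intro _ rfl)).trans hx1
    have h2 := (hxm.of_dvd (Dvd.intro_left _ rfl)).trans hx2
    generalize hz : x % (p ^ e * (p - 1)) = z at h1 h2
    have hzlt : z < p ^ e * (p - 1) := hz ▸ Nat.mod_lt _ hN
    have hzg : (z : ZMod (p ^ e)) = g := by
      rw [(ZMod.natCast_eq_natCast_iff _ _ _).mpr h1, ZMod.natCast_zmod_val]
    have hzc : z.Coprime (p ^ e) := by
      rw [← ZMod.isUnit_iff_coprime, hzg]
      exact g.isUnit
    have hpz : ¬ p ∣ z := fun hd => hp.one_lt.ne'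
      (Nat.eq_one_of_dvd_coprimes hzc hd (dvd_pow_self p (by omega)))
    have hz0 : 1 ≤ z := Nat.pos_of_ne_zero (by rintro rfl; simp at hpz)
    have hzu : ZMod.unitOfCoprime z hzc = g := Units.ext (by simpa using hzg)
    refine ⟨z, Finset.mem_filter.mpr ⟨Finset.mem_Icc.mpr ⟨hz0, hzlt.le⟩, ⟨hpz, ?_⟩, h2⟩, hzu⟩
    rw [hPQ z hzc h2, hzu]
    exact (Finset.mem_filter.mp hg).2

theorem card_fixedPoints_eq_gcdSum {p n e k : ℕ} (hp : p.Prime) (hp2 : p ≠ 2) (hn : 0 < n)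
    (he : 1 ≤ e) (hke : k ≤ e - 1)
    (hk : ∀ i, 1 ≤ i → (e ≤ i + (i + padicValNat p n) ↔ e ≤ i + k)) :
    (fixedPoints p e n).card = gcdSum p n k := by
  have : NeZero (p ^ e) := ⟨(Nat.pow_pos hp.pos).ne'⟩
  have hp1 : 0 < p - 1 := by have := hp.two_le; omega
  -- `(x - 1) % (p - 1) + 1` is the representative of `x` modulo `p - 1` in `[1, p - 1]`.
  have hrep : ∀ x y, 1 ≤ x → y ∈ Finset.Icc 1 (p - 1) →
      ((x - 1) % (p - 1) + 1 = y ↔ x ≡ y [MOD (p - 1)]) := by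
    intro x y hx hy
    obtain ⟨hy1, hy2⟩ := Finset.mem_Icc.mp hy
    obtain ⟨x, rfl⟩ := Nat.exists_eq_add_of_le' hx
    obtain ⟨y, rfl⟩ := Nat.exists_eq_add_of_le' hy1
    rw [Nat.add_sub_cancel, Nat.add_left_inj]
    constructor
    · intro h
      exact Nat.ModEq.add_right 1 (h ▸ (Nat.mod_modEq x (p - 1)).symm)
    · intro h
      have h' : x % (p - 1) = y % (p - 1) := Nat.ModEq.add_right_cancel' 1 h
      rw [h', Nat.mod_eq_of_lt (by omega)]
  unfold gcdSum
  rw [← Finset.sum_add_distrib, Finset.card_eq_sum_card_fiberwise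
    (f := fun x => (x - 1) % (p - 1) + 1) (t := Finset.Icc 1 (p - 1))]
  · refine Finset.sum_congr rfl fun y hy => ?_
    have hy0 : 0 < y := (Finset.mem_Icc.mp hy).1
    rw [← card_units_satisfying (n := n) hp hp2 he hke,
      ← card_filter_modEq_eq_card_units (y := y) hp he (fun x => x ^ (x ^ n) ≡ x [MOD p ^ e])]
    · rw [fixedPoints, Finset.filter_filter]
      congr 1
      refine Finset.filter_congr fun x hx => ?_
      rw [hrep x y (Finset.mem_Icc.mp hx).1 hy]
    · intro x hc hxy
      refine self_power_modEq_iff hp hp2 hn he (fun hd => ?_) hk hc hy0 hxy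
      exact hp.one_lt.ne' (Nat.eq_one_of_dvd_coprimes hc hd (dvd_pow_self p (by omega)))
  · intro x _
    have := Nat.mod_lt (x - 1) hp1
    simp only [Finset.coe_Icc, Set.mem_Icc]
    omega

/-! ### Sums of gcds as divisor sums -/

theorem card_filter_Icc_modEq {m d : ℕ} (hm : 0 < m) (hd : d ∣ m) (v : ℕ) :
    ((Finset.Icc 1 m).filter fun y => y ≡ v [MOD d]).card = m / d := by
  obtain ⟨q, rfl⟩ := hd
  have hd0 : 0 < d := Nat.pos_of_mul_pos_right hm
  have h := Nat.Ioc_filter_modEq_card 0 (d * q) hd0 v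
  have hd' : (d : ℚ) ≠ 0 := by exact_mod_cast hd0.ne'
  have hdiv : (((d * q : ℕ) : ℚ) - v) / d = ((0 : ℕ) - v : ℚ) / d + (q : ℤ) := by
    push_cast
    field_simp
    ring
  rw [hdiv, Int.floor_add_intCast, add_sub_cancel_left, max_eq_left (Int.natCast_nonneg q)] at h
  rw [Nat.mul_div_cancel_left q hd0]
  exact_mod_cast h

theorem card_filter_Icc_dvd_pow_sub_one {m d : ℕ} (hm : 0 < m) (hd : d ∣ m) (n : ℕ) :
    ((Finset.Icc 1 m).filter fun y => d ∣ y ^ n - 1).card = m / d * rootCount n d := by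
  have : NeZero d := ⟨(Nat.pos_of_dvd_of_pos hd hm).ne'⟩
  classical
  have hcast : ∀ y, 1 ≤ y → (d ∣ y ^ n - 1 ↔ (y : ZMod d) ^ n - 1 = 0) := by
    intro y hy
    rw [← ZMod.natCast_eq_zero_iff, Nat.cast_sub (Nat.pow_pos hy)]
    push_cast
    rfl
  rw [rootCount, Nat.card_eq_fintype_card, Fintype.card_subtype, mul_comm, ← smul_eq_mul,
    ← Finset.sum_const, Finset.card_eq_sum_card_fiberwise (f := fun y : ℕ => (y : ZMod d))
      (t := Finset.univ.filter fun z : ZMod d => z ^ n - 1 = 0)]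
  · refine Finset.sum_congr rfl fun z hz => ?_
    rw [← card_filter_Icc_modEq hm hd z.val, Finset.filter_filter]
    congr 1
    refine Finset.filter_congr fun y hy => ?_
    rw [hcast y (Finset.mem_Icc.mp hy).1, ← ZMod.natCast_eq_natCast_iff, ZMod.natCast_zmod_val]
    constructor
    · exact fun h => h.2
    · rintro rfl
      exact ⟨(Finset.mem_filter.mp hz).2, rfl⟩
  · intro y hy
    obtain ⟨hy1, hy2⟩ := Finset.mem_filter.mp hy
    simpa using (hcast y (Finset.mem_Icc.mp hy1).1).mp hy2

theorem sum_gcd_pow_sub_one {m D : ℕ} (hm : 0 < m) (hD : D ∣ m) (n : ℕ) :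
    ∑ y ∈ Finset.Icc 1 m, D.gcd (y ^ n - 1) =
      ∑ d ∈ D.divisors, d.totient * (m / d) * rootCount n d := by
  have hD0 : D ≠ 0 := (Nat.pos_of_dvd_of_pos hD hm).ne'
  have h : ∀ y, D.gcd (y ^ n - 1) =
      ∑ d ∈ D.divisors, if d ∣ y ^ n - 1 then d.totient else 0 := by
    intro y
    rw [← Nat.sum_totient (D.gcd (y ^ n - 1)), ← Finset.sum_filter]
    congr 1
    ext d
    simp [Nat.dvd_gcd_iff, hD0]
  simp only [h]
  rw [Finset.sum_comm]
  refine Finset.sum_congr rfl fun d hd => ?_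
  rw [← Finset.sum_filter, Finset.sum_const, smul_eq_mul,
    card_filter_Icc_dvd_pow_sub_one hm ((Nat.dvd_of_mem_divisors hd).trans hD)]
  ring

theorem gcdSum_eq_divisorSum {p : ℕ} (hp : p.Prime) (n k : ℕ) :
    gcdSum p n k = divisorSum p n k := by
  have hp1 : 0 < p - 1 := by have := hp.two_le; omega
  have h := sum_gcd_pow_sub_one hp1 (Nat.gcd_dvd_right n (p - 1)) n
  rw [gcdSum, divisorSum, sum_gcd_pow_sub_one hp1 dvd_rfl, ← Finset.sum_mul, ← Finset.sum_mul, ← h]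
  simp only [Nat.gcd_comm n (p - 1), Nat.gcd_assoc]

theorem theorem3p8 (p n e : ℕ) (hp : p.Prime) (hp2 : p ≠ 2) (hn : 0 < n) (hpn : p ∣ n)
    (he : 1 ≤ e) :
    (e ≤ padicValNat p n →
      (fixedPoints p e n).card = gcdSum p n (e - 1) ∧
      gcdSum p n (e - 1) = divisorSum p n (e - 1)) ∧
    (padicValNat p n + 1 ≤ e →
      (fixedPoints p e n).card = gcdSum p n ((e + padicValNat p n) / 2) ∧
      gcdSum p n ((e + padicValNat p n) / 2) =
        divisorSum p n ((e + padicValNat p n) / 2)) := by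
  -- Both choices of `k` satisfy `e ≤ 2 i + v_p n ↔ e ≤ i + k` for all `i ≥ 1`.
  refine ⟨fun h => ⟨?_, gcdSum_eq_divisorSum hp n _⟩, fun h => ⟨?_, gcdSum_eq_divisorSum hp n _⟩⟩
  · exact card_fixedPoints_eq_gcdSum hp hp2 hn he le_rfl fun i hi => by omega
  · exact card_fixedPoints_eq_gcdSum hp hp2 hn he (by omega) fun i hi => by omega
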